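/- There is an absolute constant $C>0$ such that the following holds for all integers $d\ge 1$ and $k\ge 0$. Let $\vec g\in\mathbb R^{d^k}$ be a vector of i.i.d. standard normal entries and let $A=\vec g\vec g^{\intercal}\in\mathbb R^{d^k\times d^k}$. For each $i\in\{1,\dots,k\}$ fix a type, complex Rademacher or complex Gaussian. Let $\vec x=\vec x_1\otimes\cdots\otimes\vec x_k$, where $\vec x_1,\dots,\vec x_k\in\mathbb C^d$ are independent of each other and of $\vec g$, and $\vec x_i=\frac1{\sqrt2}\vec r_i+\frac{\mathrm i}{\sqrt2}\vec m_i$ with $\vec r_i,\vec m_i\in\mathbb R^d$ independent vectors whose entries are all i.i.d. uniform on $\{\pm1\}$ (Rademacher type) or all i.i.d. standard normal (Gaussian type). Then $\vec x^{\mathsf H}A\vec x$ has finite second moment and, with probability at least $\frac34$ over $\vec g$, \[ \operatorname{Var}\bigl[\vec x^{\mathsf H}A\vec x\,\big|\,\vec g\bigr]\;\le\; C\Bigl(1+\frac1d\Bigr)^{k}\bigl(\operatorname{tr}A\bigr)^2 . \] Moreover, let $\vec x^{(1)},\dots,\vec x^{(\ell)}$ be independent copies of $\vec x$ that are jointly independent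 of $\vec g$, and let $H_\ell(A)=\frac1\ell\sum_{t=1}^{\ell}(\vec x^{(t)})^{\mathsf H}A\,\vec x^{(t)}$ be the Kronecker-Hutchinson Estimator. For every $\varepsilon>0$ and every integer $\ell\ge \frac{C}{\varepsilon^2}\bigl(1+\frac1d\bigr)^k$, with probability at least $\frac23$ (over $\vec g$ and the queries) one has \[ \bigl|H_\ell(A)-\operatorname{tr}A\bigr|\le\varepsilon\operatorname{tr}A . \] -/

import Mathlib

open MeasureTheory ProbabilityTheory

/-- The two kinds of query vectors: Rademacher (uniform signs) or standard normal Gaussian. -/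
inductive QueryKind where
  | rademacher
  | gaussian

/-- The Rademacher distribution on `ℝ`: the values `1` and `-1` with probability `1/2` each. -/
noncomputable def rademacherReal : Measure ℝ :=
  (2⁻¹ : ENNReal) • Measure.dirac (1 : ℝ) + (2⁻¹ : ENNReal) • Measure.dirac (-1 : ℝ)

/-- The law of one real entry of the given kind. -/
noncomputable def QueryKind.realLaw : QueryKind → Measure ℝ
  | .rademacher => rademacherReal
  | .gaussian => gaussianReal 0 1

/-- The law on `ℂ^d` of the complex Rademacher, respectively complex Gaussian, vector
`(r + i m) / √2`, where `r` and `m` are independent real vectors with i.i.d. entries of the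
given kind. -/
noncomputable def complexVectorLaw (d : ℕ) (κ : QueryKind) : Measure (Fin d → ℂ) :=
  ((Measure.pi fun _ : Fin d => κ.realLaw).prod (Measure.pi fun _ : Fin d => κ.realLaw)).map
    fun p j => ((p.1 j : ℂ) + Complex.I * (p.2 j : ℂ)) / (Real.sqrt 2 : ℂ)

/-- The law of a standard normal vector in `ℝ^(d^k)`. The `d^k` coordinates are indexed by the
multi-indices `(j₁, …, j_k)` with `1 ≤ j_i ≤ d`, that is by `Fin k → Fin d`. -/
noncomputable def stdNormalLaw (d k : ℕ) : Measure ((Fin k → Fin d) → ℝ) :=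
  Measure.pi fun _ => gaussianReal 0 1

/-- The Kronecker product `x₁ ⊗ ⋯ ⊗ x_k` of `k` vectors in `ℂ^d`, whose coordinate at the
multi-index `(j₁, …, j_k)` is `x₁(j₁) ⋯ x_k(j_k)`. -/
def kroneckerVec {d k : ℕ} (x : Fin k → Fin d → ℂ) : (Fin k → Fin d) → ℂ :=
  fun j => ∏ i, x i (j i)

/-- The rank-one matrix `g gᵀ`. -/
def rankOne {n : Type*} (g : n → ℝ) : Matrix n n ℝ :=
  Matrix.vecMulVec g g

/-- The quadratic form `xᴴ A x` of a real matrix `A` at a complex vector `x`. -/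
def hermForm {n : Type*} [Fintype n] (A : Matrix n n ℝ) (x : n → ℂ) : ℂ :=
  star x ⬝ᵥ Matrix.mulVec (A.map fun a : ℝ => (a : ℂ)) x

/-- The (Kronecker-)Hutchinson estimator `H_ℓ(A) = (1/ℓ) ∑_t x_tᴴ A x_t` from `ℓ` query
vectors. -/
noncomputable def hutchinson {n : Type*} [Fintype n] {ℓ : ℕ} (A : Matrix n n ℝ)
    (x : Fin ℓ → n → ℂ) : ℂ :=
  (1 / (ℓ : ℂ)) * ∑ t, hermForm A (x t)

/-- The conditional variance `Var[Z | m] = E[|Z - E[Z | m]|² | m]` of a complex random variable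
`Z` with respect to a σ-algebra `m`. -/
noncomputable def complexCondVar {Ω : Type*} {mΩ : MeasurableSpace Ω} (P : Measure Ω)
    (m : MeasurableSpace Ω) (Z : Ω → ℂ) : Ω → ℝ :=
  P[fun ω => ‖Z ω - (P[Z | m]) ω‖ ^ 2 | m]

/-!
# Kronecker-Hutchinson estimation of the trace of a random rank-one matrix

Write `T = |g|² = tr g gᵀ`, `n = d^k` and `x = x₁ ⊗ ⋯ ⊗ x_k`. The quadratic form of `g gᵀ` at `x`
is `|⟨g, x⟩|²` (`hermForm_rankOne`). The factors `x_i` are isotropic, hence so is `x`, and the mean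
of the form over `x` is exactly `T` (`integral_queryForm`). The conditional variance is therefore at
most the second moment `M(g) = E_x |⟨g, x⟩|⁴`.

For a typical `g` this second moment is controlled by averaging over `g` first. For fixed `x` the
real and imaginary parts of `⟨g, x⟩` are Gaussian, so `E_g |⟨g, x⟩|⁴ ≤ 6 |x|⁴`, and
`E |x|⁴ = ∏ E |x_i|⁴ ≤ (d² + d)^k = n² (1 + 1/d)^k` because norms of Kronecker products multiply
(`integral_queryFormSecondMoment_le`). By Markov's inequality `M(g) ≤ 48 n² (1 + 1/d)^k` outside an
event of probability `1/8`. A small-ball estimate (`gaussian_real_sum_sq_lt_le`) shows that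
`T ≥ n / 512` outside another event of probability `1/8`. So
`M(g) ≤ 48 · 512² (1 + 1/d)^k T²` with probability at least `3/4`
(`stdNormalLaw_real_compl_concentratedSet_le`), which is the variance bound.

For the estimator, `g` and the `ℓ` queries have a product law (`hasLaw_queries`). For each `g` as
above Chebyshev's inequality bounds the failure probability over the queries by `1/12`, and Fubini's
theorem gives a total failure probability of at most `1/4 + 1/12 = 1/3`
(`prod_real_queryFailureSet_le`).
-/

open scoped ENNReal NNReal

/-! ### Random variables with all moments -/

/-- All absolute moments of `f` are finite. The essentially bounded case `p = ∞` is excluded, so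
that Gaussian variables qualify, and the class is closed under products. -/
def HasAllMoments {Ω E : Type*} [MeasurableSpace Ω] [NormedAddCommGroup E] (f : Ω → E)
    (μ : Measure Ω) : Prop :=
  ∀ p : ℝ≥0∞, p ≠ ∞ → MemLp f p μ

namespace HasAllMoments

variable {Ω Ω' E : Type*} [MeasurableSpace Ω] [MeasurableSpace Ω'] {μ : Measure Ω}
  {ν : Measure Ω'} {ι : Type*}

lemma memLp_two [NormedAddCommGroup E] {f : Ω → E} (hf : HasAllMoments f μ) : MemLp f 2 μ :=
  hf 2 (by simp)

lemma integrable [NormedAddCommGroup E] {f : Ω → E} (hf : HasAllMoments f μ) : Integrable f μ :=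
  memLp_one_iff_integrable.1 (hf 1 (by simp))

lemma const [NormedAddCommGroup E] [IsFiniteMeasure μ] (c : E) :
    HasAllMoments (fun _ : Ω => c) μ :=
  fun _ _ => memLp_const c

lemma add [NormedAddCommGroup E] {f g : Ω → E} (hf : HasAllMoments f μ)
    (hg : HasAllMoments g μ) : HasAllMoments (fun ω => f ω + g ω) μ :=
  fun p hp => (hf p hp).add (hg p hp)

lemma sub [NormedAddCommGroup E] {f g : Ω → E} (hf : HasAllMoments f μ)
    (hg : HasAllMoments g μ) : HasAllMoments (fun ω => f ω - g ω) μ :=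
  fun p hp => (hf p hp).sub (hg p hp)

lemma norm [NormedAddCommGroup E] {f : Ω → E} (hf : HasAllMoments f μ) :
    HasAllMoments (fun ω => ‖f ω‖) μ :=
  fun p hp => (hf p hp).norm

lemma sum [NormedAddCommGroup E] {f : ι → Ω → E} (s : Finset ι)
    (hf : ∀ i, HasAllMoments (f i) μ) : HasAllMoments (fun ω => ∑ i ∈ s, f i ω) μ :=
  fun p hp => memLp_finsetSum s fun i _ => hf i p hp

/-- Hölder's inequality with exponents `2p, 2p, p`. -/
lemma mul [NormedRing E] {f g : Ω → E} (hf : HasAllMoments f μ)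
    (hg : HasAllMoments g μ) : HasAllMoments (fun ω => f ω * g ω) μ := by
  intro p hp
  have h : ENNReal.HolderTriple (2 * p) (2 * p) p := ⟨by
    rw [ENNReal.mul_inv (by simp) (by simp), ← add_mul, ENNReal.inv_two_add_inv_two, one_mul]⟩
  exact (hg (2 * p) (ENNReal.mul_ne_top (by simp) hp)).mul
    (hf (2 * p) (ENNReal.mul_ne_top (by simp) hp))

lemma pow [NormedRing E] [IsFiniteMeasure μ] {f : Ω → E} (hf : HasAllMoments f μ) (n : ℕ) :
    HasAllMoments (fun ω => f ω ^ n) μ := by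
  induction n with
  | zero => simpa using HasAllMoments.const (1 : E)
  | succ n ih => simpa only [pow_succ] using ih.mul hf

lemma prod [NormedCommRing E] [IsFiniteMeasure μ] {f : ι → Ω → E} (s : Finset ι)
    (hf : ∀ i, HasAllMoments (f i) μ) : HasAllMoments (fun ω => ∏ i ∈ s, f i ω) μ := by
  classical
  induction s using Finset.induction_on with
  | empty => simpa using HasAllMoments.const (1 : E)
  | insert i s hi ih => simpa only [Finset.prod_insert hi] using (hf i).mul ih

lemma comp [NormedAddCommGroup E] {f : Ω' → E} {φ : Ω → Ω'} (hf : HasAllMoments f ν)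
    (hφ : MeasurePreserving φ μ ν) : HasAllMoments (fun ω => f (φ ω)) μ :=
  fun p hp => (hf p hp).comp_measurePreserving hφ

lemma ofReal {f : Ω → ℝ} (hf : HasAllMoments f μ) : HasAllMoments (fun ω => (f ω : ℂ)) μ :=
  fun p hp => (hf p hp).ofReal

end HasAllMoments

/-! ### Moments of the entries -/

lemma hasAllMoments_id_gaussianReal (m : ℝ) (v : ℝ≥0) :
    HasAllMoments (fun x : ℝ => x) (gaussianReal m v) :=
  fun p hp => memLp_id_gaussianReal' p hp

/-- The fourth moment is the fourth derivative at `0` of the moment generating function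
`t ↦ exp (v t² / 2)`. -/
lemma integral_pow_four_gaussianReal (v : ℝ≥0) :
    ∫ x, x ^ 4 ∂gaussianReal 0 v = 3 * (v : ℝ) ^ 2 := by
  have h0 : mgf (fun x ↦ x) (gaussianReal 0 v) = fun t => Real.exp (v * t ^ 2 / 2) := by
    rw [mgf_fun_id_gaussianReal]; simp
  have hE : ∀ t : ℝ, HasDerivAt (fun t : ℝ => Real.exp (v * t ^ 2 / 2))
      (v * t * Real.exp (v * t ^ 2 / 2)) t := fun t =>
    ((((hasDerivAt_pow 2 t).const_mul (v : ℝ)).div_const 2).exp).congr_deriv (by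
      push_cast; ring)
  have h1 : deriv (fun t : ℝ => Real.exp (v * t ^ 2 / 2)) =
      fun t => v * t * Real.exp (v * t ^ 2 / 2) := funext fun t => (hE t).deriv
  have h2 : deriv (fun t : ℝ => v * t * Real.exp (v * t ^ 2 / 2)) =
      fun t => (v + (v : ℝ) ^ 2 * t ^ 2) * Real.exp (v * t ^ 2 / 2) := funext fun t =>
    ((((hasDerivAt_id' t).const_mul (v : ℝ)).fun_mul (hE t)).congr_deriv (by ring)).deriv
  have h3 : deriv (fun t : ℝ => (v + (v : ℝ) ^ 2 * t ^ 2) * Real.exp (v * t ^ 2 / 2)) =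
      fun t => (3 * (v : ℝ) ^ 2 * t + (v : ℝ) ^ 3 * t ^ 3) * Real.exp (v * t ^ 2 / 2) :=
    funext fun t => (((((hasDerivAt_pow 2 t).const_mul ((v : ℝ) ^ 2)).const_add
      (v : ℝ)).fun_mul (hE t)).congr_deriv (by push_cast; ring)).deriv
  have h4 : deriv (fun t : ℝ => (3 * (v : ℝ) ^ 2 * t + (v : ℝ) ^ 3 * t ^ 3) *
      Real.exp (v * t ^ 2 / 2)) 0 = 3 * (v : ℝ) ^ 2 :=
    (((((hasDerivAt_id' (0 : ℝ)).const_mul (3 * (v : ℝ) ^ 2)).fun_add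
      ((hasDerivAt_pow 3 (0 : ℝ)).const_mul ((v : ℝ) ^ 3))).fun_mul (hE 0)).congr_deriv
        (by simp)).deriv
  have h := iteratedDeriv_mgf_zero (X := fun x : ℝ => x) (μ := gaussianReal 0 v) (by simp) 4
  rw [h0, iteratedDeriv_succ, iteratedDeriv_succ, iteratedDeriv_succ, iteratedDeriv_one,
    h1, h2, h3, h4] at h
  simpa using h.symm

instance : IsProbabilityMeasure rademacherReal := ⟨by
  simp [rademacherReal, ENNReal.inv_two_add_inv_two]⟩

lemma integral_rademacherReal (f : ℝ → ℝ) :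
    ∫ x, f x ∂rademacherReal = (f 1 + f (-1)) / 2 := by
  have hd : ∀ a : ℝ, Integrable f ((2⁻¹ : ℝ≥0∞) • Measure.dirac a) := fun a =>
    (integrable_dirac (by simp)).smul_measure (by simp)
  rw [rademacherReal, integral_add_measure (hd _) (hd _)]
  simp [integral_smul_measure]
  ring

lemma hasAllMoments_id_rademacherReal : HasAllMoments (fun x : ℝ => x) rademacherReal := by
  intro p _
  refine MemLp.of_bound (by fun_prop) 1 ?_
  rw [rademacherReal, ae_add_measure_iff]
  constructor <;> refine Measure.ae_smul_measure ?_ _ <;> simp [ae_dirac_eq]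

namespace QueryKind

variable (κ : QueryKind)

instance : IsProbabilityMeasure κ.realLaw := by
  cases κ <;> (simp only [realLaw]; infer_instance)

lemma hasAllMoments_id : HasAllMoments (fun x : ℝ => x) κ.realLaw := by
  cases κ
  · exact hasAllMoments_id_rademacherReal
  · exact hasAllMoments_id_gaussianReal 0 1

lemma integral_id_realLaw : ∫ x, x ∂κ.realLaw = 0 := by
  cases κ
  · exact (integral_rademacherReal fun x => x).trans (by norm_num)
  · exact integral_id_gaussianReal

lemma integral_sq_realLaw : ∫ x, x ^ 2 ∂κ.realLaw = 1 := by
  cases κ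
  · exact (integral_rademacherReal fun x => x ^ 2).trans (by norm_num)
  · have h := variance_fun_id_gaussianReal (μ := 0) (v := 1)
    rw [variance_eq_integral (by fun_prop)] at h
    simpa [realLaw] using h

lemma integral_pow_four_realLaw_le : ∫ x, x ^ 4 ∂κ.realLaw ≤ 3 := by
  cases κ
  · have h := integral_rademacherReal fun x => x ^ 4
    norm_num at h
    simp only [realLaw, h]; norm_num
  · exact (integral_pow_four_gaussianReal 1).le.trans (by norm_num)

end QueryKind

/-! ### Moments of real vectors with independent entries -/

section RealVector

variable {d : ℕ} (κ : QueryKind)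

lemma hasAllMoments_eval_pi (j : Fin d) :
    HasAllMoments (fun r : Fin d → ℝ => r j) (Measure.pi fun _ => κ.realLaw) :=
  κ.hasAllMoments_id.comp (measurePreserving_eval _ j)

lemma integral_eval_pi (j : Fin d) :
    ∫ r : Fin d → ℝ, r j ∂(Measure.pi fun _ => κ.realLaw) = 0 := by
  rw [integral_comp_eval (μ := fun _ => κ.realLaw) (f := fun x : ℝ => x) (i := j)
    (by fun_prop)]
  exact κ.integral_id_realLaw

lemma integral_eval_mul_eval_pi (a b : Fin d) :
    ∫ r : Fin d → ℝ, r a * r b ∂(Measure.pi fun _ => κ.realLaw) = if a = b then 1 else 0 := by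
  split_ifs with h
  · subst h
    simp_rw [← pow_two]
    rw [integral_comp_eval (μ := fun _ => κ.realLaw) (f := fun x : ℝ => x ^ 2) (i := a)
      (by fun_prop)]
    exact κ.integral_sq_realLaw
  · have hi : IndepFun (fun r : Fin d → ℝ => r a) (fun r => r b)
        (Measure.pi fun _ => κ.realLaw) :=
      (iIndepFun_pi (μ := fun _ : Fin d => κ.realLaw) (X := fun _ x => x)
        (fun _ => by fun_prop)).indepFun h
    rw [hi.integral_fun_mul_eq_mul_integral
      (hasAllMoments_eval_pi κ a).integrable.1 (hasAllMoments_eval_pi κ b).integrable.1,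
      integral_eval_pi, zero_mul]

lemma integral_sum_sq_pi :
    ∫ r : Fin d → ℝ, ∑ j, r j ^ 2 ∂(Measure.pi fun _ => κ.realLaw) = d := by
  rw [integral_finsetSum _ fun j _ => ((hasAllMoments_eval_pi κ j).pow 2).integrable]
  simp_rw [pow_two, integral_eval_mul_eval_pi]
  simp

/-- `E S² = Var S + d²` for `S = ∑ r_j²`, and the variance of a sum of independent variables is the
sum of the variances, each at most `E r_j⁴ - 1 ≤ 2`. -/
lemma integral_sum_sq_sq_pi_le :
    ∫ r : Fin d → ℝ, (∑ j, r j ^ 2) ^ 2 ∂(Measure.pi fun _ => κ.realLaw) ≤ d ^ 2 + 2 * d := by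
  have hv := variance_sum_pi (μ := fun _ : Fin d => κ.realLaw) (X := fun _ x => x ^ 2)
    (fun _ => (κ.hasAllMoments_id.pow 2).memLp_two)
  have hS : HasAllMoments (fun r : Fin d → ℝ => ∑ j, r j ^ 2) (Measure.pi fun _ => κ.realLaw) :=
    .sum _ fun j => (hasAllMoments_eval_pi κ j).pow 2
  have h1 : Var[fun x : ℝ => x ^ 2; κ.realLaw] ≤ 2 := by
    rw [variance_eq_sub (κ.hasAllMoments_id.pow 2).memLp_two]
    have h4 := κ.integral_pow_four_realLaw_le
    simp only [Pi.pow_apply, ← pow_mul, κ.integral_sq_realLaw]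
    norm_num; linarith
  have h2 : (∑ j : Fin d, fun r : Fin d → ℝ => r j ^ 2) = fun r => ∑ j, r j ^ 2 := by
    ext r; simp
  rw [h2, variance_eq_sub hS.memLp_two, integral_sum_sq_pi] at hv
  simp only [Pi.pow_apply, Finset.sum_const, Finset.card_univ, Fintype.card_fin,
    nsmul_eq_mul] at hv
  nlinarith [(Nat.cast_nonneg d : (0 : ℝ) ≤ d)]

end RealVector

/-! ### The complex query vectors -/

section ComplexVector

variable {d : ℕ} (κ : QueryKind)

lemma measurable_complexVector :
    Measurable fun (p : (Fin d → ℝ) × (Fin d → ℝ)) (j : Fin d) =>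
      ((p.1 j : ℂ) + Complex.I * (p.2 j : ℂ)) / (Real.sqrt 2 : ℂ) := by
  fun_prop

instance : IsProbabilityMeasure (complexVectorLaw d κ) :=
  Measure.isProbabilityMeasure_map measurable_complexVector.aemeasurable

lemma hasAllMoments_fst (j : Fin d) :
    HasAllMoments (fun p : (Fin d → ℝ) × (Fin d → ℝ) => p.1 j)
      ((Measure.pi fun _ => κ.realLaw).prod (Measure.pi fun _ => κ.realLaw)) :=
  (hasAllMoments_eval_pi κ j).comp measurePreserving_fst

lemma hasAllMoments_snd (j : Fin d) :
    HasAllMoments (fun p : (Fin d → ℝ) × (Fin d → ℝ) => p.2 j)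
      ((Measure.pi fun _ => κ.realLaw).prod (Measure.pi fun _ => κ.realLaw)) :=
  (hasAllMoments_eval_pi κ j).comp measurePreserving_snd

lemma hasAllMoments_eval_complexVectorLaw (j : Fin d) :
    HasAllMoments (fun x : Fin d → ℂ => x j) (complexVectorLaw d κ) := by
  have h := ((hasAllMoments_fst κ j).ofReal.add
    ((HasAllMoments.const Complex.I).mul (hasAllMoments_snd κ j).ofReal)).mul
      (HasAllMoments.const (Real.sqrt 2 : ℂ)⁻¹)
  intro p hp
  rw [complexVectorLaw, memLp_map_measure_iff (Measurable.aestronglyMeasurable (by fun_prop))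
    measurable_complexVector.aemeasurable]
  simpa only [← div_eq_mul_inv, Function.comp_def] using h p hp

/-- The covariance matrix of a query vector is the identity: real and imaginary part both
contribute one half on the diagonal, and the mixed terms vanish by independence. -/
lemma integral_mul_conj_complexVectorLaw (a b : Fin d) :
    ∫ x : Fin d → ℂ, x a * starRingEnd ℂ (x b) ∂complexVectorLaw d κ =
      if a = b then 1 else 0 := by
  have hs : (Real.sqrt 2 : ℂ) * (Real.sqrt 2 : ℂ) = 2 := by
    rw [← Complex.ofReal_mul, Real.mul_self_sqrt (by norm_num)]; norm_num
  have hs' : (Real.sqrt 2 : ℂ) ≠ 0 := by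
    simp
  have hf := hasAllMoments_fst (d := d) κ
  have hm := hasAllMoments_snd (d := d) κ
  rw [complexVectorLaw, integral_map measurable_complexVector.aemeasurable
    (Measurable.aestronglyMeasurable (by fun_prop))]
  have hpt : ∀ p : (Fin d → ℝ) × (Fin d → ℝ),
      ((p.1 a : ℂ) + Complex.I * (p.2 a : ℂ)) / (Real.sqrt 2 : ℂ) *
        starRingEnd ℂ (((p.1 b : ℂ) + Complex.I * (p.2 b : ℂ)) / (Real.sqrt 2 : ℂ)) =
      ((p.1 a * p.1 b + p.2 a * p.2 b : ℝ) : ℂ) * (1 / 2) +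
        ((p.2 a * p.1 b - p.1 a * p.2 b : ℝ) : ℂ) * (Complex.I / 2) := by
    intro p
    simp only [map_div₀, map_add, map_mul, Complex.conj_ofReal, Complex.conj_I]
    rw [div_mul_div_comm, hs]
    push_cast
    linear_combination (-(p.2 a : ℂ) * (p.2 b : ℂ) / 2) * Complex.I_mul_I
  simp_rw [hpt]
  have e1 := (((hf a).mul (hf b)).add ((hm a).mul (hm b)))
  have e2 := (((hm a).mul (hf b)).sub ((hf a).mul (hm b)))
  rw [integral_add (e1.ofReal.mul (.const _)).integrable (e2.ofReal.mul (.const _)).integrable,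
    integral_mul_const, integral_mul_const, integral_complex_ofReal, integral_complex_ofReal,
    integral_add ((hf a).mul (hf b)).integrable ((hm a).mul (hm b)).integrable,
    integral_sub ((hm a).mul (hf b)).integrable ((hf a).mul (hm b)).integrable]
  have i1 : ∫ p : (Fin d → ℝ) × (Fin d → ℝ), p.1 a * p.1 b
      ∂((Measure.pi fun _ => κ.realLaw).prod (Measure.pi fun _ => κ.realLaw)) =
      if a = b then 1 else 0 := by
    rw [integral_fun_fst (fun r : Fin d → ℝ => r a * r b), integral_eval_mul_eval_pi]; simp
  have i2 : ∫ p : (Fin d → ℝ) × (Fin d → ℝ), p.2 a * p.2 b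
      ∂((Measure.pi fun _ => κ.realLaw).prod (Measure.pi fun _ => κ.realLaw)) =
      if a = b then 1 else 0 := by
    rw [integral_fun_snd (fun r : Fin d → ℝ => r a * r b), integral_eval_mul_eval_pi]; simp
  have i3 : ∀ i j : Fin d, ∫ p : (Fin d → ℝ) × (Fin d → ℝ), p.1 i * p.2 j
      ∂((Measure.pi fun _ => κ.realLaw).prod (Measure.pi fun _ => κ.realLaw)) = 0 := by
    intro i j
    rw [integral_prod_mul (fun r : Fin d → ℝ => r i) (fun r : Fin d → ℝ => r j),
      integral_eval_pi, zero_mul]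
  have i4 : ∫ p : (Fin d → ℝ) × (Fin d → ℝ), p.2 a * p.1 b
      ∂((Measure.pi fun _ => κ.realLaw).prod (Measure.pi fun _ => κ.realLaw)) = 0 := by
    simp_rw [mul_comm]
    exact i3 b a
  rw [i1, i2, i3, i4]
  split_ifs <;> norm_num

/-- With `S_r = ∑ r_j²` and `S_m = ∑ m_j²` the squared norm of a query vector is `(S_r + S_m) / 2`,
and `S_r`, `S_m` are independent with mean `d` and second moment at most `d² + 2d`. -/
lemma integral_sum_norm_sq_sq_complexVectorLaw_le :
    ∫ x : Fin d → ℂ, (∑ j, ‖x j‖ ^ 2) ^ 2 ∂complexVectorLaw d κ ≤ d ^ 2 + d := by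
  rw [complexVectorLaw, integral_map measurable_complexVector.aemeasurable
    (Measurable.aestronglyMeasurable (by fun_prop))]
  have hpt : ∀ p : (Fin d → ℝ) × (Fin d → ℝ),
      (∑ j, ‖((p.1 j : ℂ) + Complex.I * (p.2 j : ℂ)) / (Real.sqrt 2 : ℂ)‖ ^ 2) ^ 2 =
      (∑ j, p.1 j ^ 2) ^ 2 * (1 / 4) + (∑ j, p.2 j ^ 2) ^ 2 * (1 / 4) +
        (∑ j, p.1 j ^ 2) * (∑ j, p.2 j ^ 2) * (1 / 2) := by
    intro p
    have : ∀ j, ‖((p.1 j : ℂ) + Complex.I * (p.2 j : ℂ)) / (Real.sqrt 2 : ℂ)‖ ^ 2 =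
        (p.1 j ^ 2 + p.2 j ^ 2) / 2 := by
      intro j
      rw [norm_div, div_pow, Complex.norm_real, Real.norm_eq_abs, sq_abs,
        Real.sq_sqrt (by norm_num), mul_comm, Complex.sq_norm, Complex.normSq_add_mul_I]
    simp_rw [this, ← Finset.sum_div, Finset.sum_add_distrib]
    ring
  simp_rw [hpt]
  have hf : HasAllMoments (fun p : (Fin d → ℝ) × (Fin d → ℝ) => ∑ j, p.1 j ^ 2)
      ((Measure.pi fun _ => κ.realLaw).prod (Measure.pi fun _ => κ.realLaw)) :=
    .sum _ fun j => (hasAllMoments_fst κ j).pow 2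
  have hm : HasAllMoments (fun p : (Fin d → ℝ) × (Fin d → ℝ) => ∑ j, p.2 j ^ 2)
      ((Measure.pi fun _ => κ.realLaw).prod (Measure.pi fun _ => κ.realLaw)) :=
    .sum _ fun j => (hasAllMoments_snd κ j).pow 2
  rw [integral_add (((hf.pow 2).mul (.const _)).add ((hm.pow 2).mul (.const _))).integrable
      ((hf.mul hm).mul (.const _)).integrable,
    integral_add ((hf.pow 2).mul (.const _)).integrable ((hm.pow 2).mul (.const _)).integrable,
    integral_mul_const, integral_mul_const, integral_mul_const,
    integral_prod_mul (fun r : Fin d → ℝ => ∑ j, r j ^ 2) (fun r : Fin d → ℝ => ∑ j, r j ^ 2),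
    integral_fun_fst (fun r : Fin d → ℝ => (∑ j, r j ^ 2) ^ 2),
    integral_fun_snd (fun r : Fin d → ℝ => (∑ j, r j ^ 2) ^ 2),
    integral_sum_sq_pi]
  have := integral_sum_sq_sq_pi_le (d := d) κ
  simp only [probReal_univ, one_smul]
  linarith

end ComplexVector

/-! ### Kronecker products of query vectors -/

section Kronecker

variable {d k : ℕ} (κ : Fin k → QueryKind)

/-- The joint law of the `k` independent factors of one query vector. -/
noncomputable def queryLaw (d : ℕ) {k : ℕ} (κ : Fin k → QueryKind) :
    Measure (Fin k → Fin d → ℂ) :=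
  Measure.pi fun i => complexVectorLaw d (κ i)

instance : IsProbabilityMeasure (queryLaw d κ) := by
  unfold queryLaw; infer_instance

lemma hasAllMoments_kroneckerVec (j : Fin k → Fin d) :
    HasAllMoments (fun x : Fin k → Fin d → ℂ => kroneckerVec x j) (queryLaw d κ) :=
  .prod _ fun i => (hasAllMoments_eval_complexVectorLaw (κ i) (j i)).comp
    (measurePreserving_eval _ i)

/-- Kronecker products of independent isotropic vectors are isotropic. -/
lemma integral_kroneckerVec_mul_conj (a b : Fin k → Fin d) :
    ∫ x, kroneckerVec x a * starRingEnd ℂ (kroneckerVec x b) ∂queryLaw d κ =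
      if a = b then 1 else 0 := by
  simp only [kroneckerVec, map_prod, ← Finset.prod_mul_distrib]
  rw [queryLaw, integral_fintype_prod_eq_prod
    (fun i (y : Fin d → ℂ) => y (a i) * starRingEnd ℂ (y (b i)))]
  simp_rw [integral_mul_conj_complexVectorLaw, Finset.prod_ite_zero, funext_iff]
  simp

lemma sum_norm_sq_kroneckerVec (x : Fin k → Fin d → ℂ) :
    ∑ j, ‖kroneckerVec x j‖ ^ 2 = ∏ i, ∑ j, ‖x i j‖ ^ 2 := by
  rw [Finset.prod_univ_sum, Fintype.piFinset_univ]
  simp [kroneckerVec, Finset.prod_pow]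

lemma integral_sum_norm_sq_sq_kroneckerVec_le :
    ∫ x, (∑ j, ‖kroneckerVec x j‖ ^ 2) ^ 2 ∂queryLaw d κ ≤ ((d : ℝ) ^ 2 + d) ^ k := by
  simp_rw [sum_norm_sq_kroneckerVec, ← Finset.prod_pow]
  rw [queryLaw, integral_fintype_prod_eq_prod
    (fun _ (y : Fin d → ℂ) => (∑ j, ‖y j‖ ^ 2) ^ 2)]
  refine (Finset.prod_le_prod (fun i _ => integral_nonneg fun _ => by positivity)
    fun i _ => integral_sum_norm_sq_sq_complexVectorLaw_le (κ i)).trans ?_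
  simp

end Kronecker

/-! ### Moments and small balls of a standard normal vector -/

section StdNormal

variable {ι : Type*} [Fintype ι]

lemma hasAllMoments_eval_gaussian (j : ι) :
    HasAllMoments (fun g : ι → ℝ => g j) (Measure.pi fun _ => gaussianReal 0 1) :=
  (hasAllMoments_id_gaussianReal 0 1).comp (measurePreserving_eval _ j)

lemma map_sum_mul_gaussian (a : ι → ℝ) :
    (Measure.pi fun _ : ι => gaussianReal 0 1).map (fun g => ∑ j, a j * g j) =
      gaussianReal 0 (∑ j, a j ^ 2).toNNReal := by
  have hL : (fun g : ι → ℝ => ∑ j, a j * g j) =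
      (innerSL ℝ (WithLp.toLp 2 a : EuclideanSpace ℝ ι)) ∘ WithLp.toLp 2 := by
    ext g
    simp [PiLp.inner_apply, mul_comm]
  rw [hL, ← Measure.map_map (by fun_prop) (by fun_prop), map_pi_eq_stdGaussian,
    IsGaussian.map_eq_gaussianReal, variance_dual_stdGaussian, integral_strongDual_stdGaussian,
    innerSL_apply_norm, EuclideanSpace.real_norm_sq_eq]

lemma integral_sum_mul_pow_four_gaussian (a : ι → ℝ) :
    ∫ g, (∑ j, a j * g j) ^ 4 ∂(Measure.pi fun _ : ι => gaussianReal 0 1) =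
      3 * (∑ j, a j ^ 2) ^ 2 := by
  rw [← integral_map (φ := fun g : ι → ℝ => ∑ j, a j * g j) (f := fun x : ℝ => x ^ 4)
    (Measurable.aemeasurable (by fun_prop)) (by fun_prop), map_sum_mul_gaussian,
    integral_pow_four_gaussianReal,
    Real.coe_toNNReal _ (by positivity)]

/-- For a complex vector `z = u + i v` the bound follows from
`|g·z|⁴ = ((g·u)² + (g·v)²)² ≤ 2 (g·u)⁴ + 2 (g·v)⁴`. -/
lemma integral_norm_sum_mul_pow_four_gaussian_le (z : ι → ℂ) :
    ∫ g, ‖∑ j, (g j : ℂ) * z j‖ ^ 4 ∂(Measure.pi fun _ : ι => gaussianReal 0 1) ≤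
      6 * (∑ j, ‖z j‖ ^ 2) ^ 2 := by
  have hm : ∀ a : ι → ℝ, HasAllMoments (fun g : ι → ℝ => ∑ j, a j * g j)
      (Measure.pi fun _ : ι => gaussianReal 0 1) := fun a =>
    .sum _ fun j => (HasAllMoments.const (a j)).mul (hasAllMoments_eval_gaussian j)
  have hpt : ∀ g : ι → ℝ, ‖∑ j, (g j : ℂ) * z j‖ ^ 4 ≤
      2 * (∑ j, (z j).re * g j) ^ 4 + 2 * (∑ j, (z j).im * g j) ^ 4 := by
    intro g
    have h : ‖∑ j, (g j : ℂ) * z j‖ ^ 2 =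
        (∑ j, (z j).re * g j) ^ 2 + (∑ j, (z j).im * g j) ^ 2 := by
      rw [Complex.sq_norm, Complex.normSq_apply]
      simp [mul_comm, pow_two]
    calc ‖∑ j, (g j : ℂ) * z j‖ ^ 4 = (‖∑ j, (g j : ℂ) * z j‖ ^ 2) ^ 2 := by ring
      _ ≤ _ := by
        rw [h]
        nlinarith [sq_nonneg ((∑ j, (z j).re * g j) ^ 2 - (∑ j, (z j).im * g j) ^ 2)]
  have h1 := ((HasAllMoments.const (2 : ℝ)).mul ((hm fun j => (z j).re).pow 4)).integrable
  have h2 := ((HasAllMoments.const (2 : ℝ)).mul ((hm fun j => (z j).im).pow 4)).integrable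
  refine (integral_mono_of_nonneg (ae_of_all _ fun g => by positivity) (h1.add h2)
    (ae_of_all _ hpt)).trans ?_
  rw [integral_add' h1 h2, integral_const_mul, integral_const_mul,
    integral_sum_mul_pow_four_gaussian, integral_sum_mul_pow_four_gaussian]
  have hz : ∑ j, ‖z j‖ ^ 2 = ∑ j, (z j).re ^ 2 + ∑ j, (z j).im ^ 2 := by
    rw [← Finset.sum_add_distrib]
    refine Finset.sum_congr rfl fun j _ => ?_
    rw [Complex.sq_norm, Complex.normSq_apply]; ring
  rw [hz]
  have hu : 0 ≤ ∑ j, (z j).re ^ 2 := by positivity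
  have hv : 0 ≤ ∑ j, (z j).im ^ 2 := by positivity
  nlinarith [mul_nonneg hu hv]

lemma gaussianReal_real_Ioo_le {δ : ℝ} (hδ : 0 ≤ δ) :
    (gaussianReal 0 1).real (Set.Ioo (-δ) δ) ≤ δ := by
  have hpdf : ∀ x, gaussianPDF 0 1 x ≤ ENNReal.ofReal (1 / 2) := by
    intro x
    refine ENNReal.ofReal_le_ofReal ?_
    have h2 : (2 : ℝ) ≤ √(2 * Real.pi * (1 : ℝ≥0)) := by
      refine Real.le_sqrt_of_sq_le ?_
      have := Real.pi_gt_three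
      norm_num; linarith
    rw [gaussianPDFReal, one_div]
    refine mul_le_of_le_one_right (by positivity) (Real.exp_le_one_iff.2 ?_) |>.trans
      (inv_anti₀ (by norm_num) h2)
    exact div_nonpos_of_nonpos_of_nonneg (neg_nonpos.2 (sq_nonneg _)) (by positivity)
  refine ENNReal.toReal_le_of_le_ofReal hδ ?_
  rw [gaussianReal_apply _ one_ne_zero]
  refine (setLIntegral_mono measurable_const fun x _ => hpdf x).trans ?_
  rw [setLIntegral_const, Real.volume_Ioo, ← ENNReal.ofReal_mul (by norm_num)]
  exact (congrArg _ (by ring)).le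

/-- Small-ball estimate. If `|g|² < n / 512`, then at least half of the coordinates lie in
`(-1/16, 1/16)`; the expected number of such coordinates is at most `n / 16`, so Markov's
inequality applies. Unlike Chebyshev's inequality this works in every dimension `n ≥ 1`. -/
lemma gaussian_real_sum_sq_lt_le [Nonempty ι] :
    (Measure.pi fun _ : ι => gaussianReal 0 1).real
      {g | ∑ j, g j ^ 2 < (Fintype.card ι : ℝ) / 512} ≤ 1 / 8 := by
  set n : ℝ := (Fintype.card ι : ℝ) with hn
  have hn0 : 0 < n := by simp [hn, Fintype.card_pos]
  set I : Set ℝ := Set.Ioo (-(1 / 16)) (1 / 16) with hI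
  have hIm : MeasurableSet I := measurableSet_Ioo
  set B : (ι → ℝ) → ℝ := fun g => ∑ j, I.indicator 1 (g j) with hB
  have hBi : ∀ j : ι, Integrable (fun g : ι → ℝ => I.indicator (1 : ℝ → ℝ) (g j))
      (Measure.pi fun _ : ι => gaussianReal 0 1) := fun j =>
    (measurePreserving_eval (fun _ : ι => gaussianReal 0 1) j).integrable_comp_of_integrable
      ((integrable_const (1 : ℝ)).indicator hIm)
  have hEB : ∫ g, B g ∂(Measure.pi fun _ : ι => gaussianReal 0 1) ≤ n * (1 / 16) := by
    rw [integral_finsetSum _ fun j _ => hBi j]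
    have : ∀ j : ι, ∫ g : ι → ℝ, I.indicator (1 : ℝ → ℝ) (g j)
        ∂(Measure.pi fun _ : ι => gaussianReal 0 1) ≤ 1 / 16 := by
      intro j
      rw [integral_comp_eval (μ := fun _ : ι => gaussianReal 0 1)
        (f := I.indicator (1 : ℝ → ℝ)) (i := j)
        ((measurable_one.indicator hIm).aestronglyMeasurable), integral_indicator_one hIm]
      exact gaussianReal_real_Ioo_le (by norm_num)
    refine (Finset.sum_le_sum fun j _ => this j).trans ?_
    simp [hn]
  have hsub : {g : ι → ℝ | ∑ j, g j ^ 2 < n / 512} ⊆ {g | n / 2 ≤ B g} := by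
    intro g hg
    simp only [Set.mem_ofPred_eq] at hg ⊢
    have hpt : ∀ j, (1 / 256 : ℝ) - 1 / 256 * I.indicator 1 (g j) ≤ g j ^ 2 := by
      intro j
      by_cases h : g j ∈ I
      · rw [Set.indicator_of_mem h]; simp; positivity
      · rw [Set.indicator_of_notMem h]
        have : 1 / 16 ≤ |g j| := by
          by_contra! hc
          exact h (abs_lt.1 hc)
        rw [← sq_abs]; nlinarith
    have := Finset.sum_le_sum fun j (_ : j ∈ Finset.univ) => hpt j
    rw [Finset.sum_sub_distrib, ← Finset.mul_sum, Finset.sum_const, Finset.card_univ,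
      nsmul_eq_mul] at this
    change n * (1 / 256) - 1 / 256 * B g ≤ _ at this
    linarith
  have hmk := mul_meas_ge_le_integral_of_nonneg (μ := Measure.pi fun _ : ι => gaussianReal 0 1)
    (f := B) (ae_of_all _ fun g => Finset.sum_nonneg fun j _ =>
      Set.indicator_nonneg (fun _ _ => zero_le_one) _)
    (integrable_finsetSum _ fun j _ => hBi j) (n / 2)
  refine (measureReal_mono hsub).trans ?_
  nlinarith [hmk.trans hEB]

end StdNormal

/-! ### The quadratic form at a Kronecker product -/

lemma trace_rankOne {n : Type*} [Fintype n] (g : n → ℝ) :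
    (rankOne g).trace = ∑ j, g j ^ 2 := by
  simp [rankOne, Matrix.trace, Matrix.vecMulVec_apply, pow_two]

lemma hermForm_rankOne {n : Type*} [Fintype n] (g : n → ℝ) (z : n → ℂ) :
    hermForm (rankOne g) z = ((‖∑ j, (g j : ℂ) * z j‖ ^ 2 : ℝ) : ℂ) := by
  rw [Complex.ofReal_pow, ← Complex.conj_mul', map_sum, Finset.sum_mul]
  simp only [hermForm, dotProduct, Matrix.mulVec, rankOne, Matrix.map_apply,
    Matrix.vecMulVec_apply, Pi.star_apply, Finset.mul_sum, map_mul, Complex.conj_ofReal]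
  refine Finset.sum_congr rfl fun a _ => Finset.sum_congr rfl fun b _ => ?_
  rw [Complex.ofReal_mul, ← starRingEnd_apply]
  ring

section QueryForm

variable {d k : ℕ} (κ : Fin k → QueryKind)

/-- The value `|⟨g, x₁ ⊗ ⋯ ⊗ x_k⟩|²` of the quadratic form of `g gᵀ` at a Kronecker product. -/
noncomputable def queryForm (g : (Fin k → Fin d) → ℝ) (x : Fin k → Fin d → ℂ) : ℝ :=
  ‖∑ j, (g j : ℂ) * kroneckerVec x j‖ ^ 2

/-- The second moment, over the query vector, of the quadratic form of `g gᵀ`. -/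
noncomputable def queryFormSecondMoment (g : (Fin k → Fin d) → ℝ) : ℝ :=
  ∫ x, queryForm g x ^ 2 ∂queryLaw d κ

lemma measurable_queryForm :
    Measurable fun p : ((Fin k → Fin d) → ℝ) × (Fin k → Fin d → ℂ) => queryForm p.1 p.2 := by
  have h : ∀ j : Fin k → Fin d, Measurable fun x : Fin k → Fin d → ℂ => kroneckerVec x j := by
    intro j
    unfold kroneckerVec
    fun_prop
  have h' : Measurable fun p : ((Fin k → Fin d) → ℝ) × (Fin k → Fin d → ℂ) =>
      ∑ j, (p.1 j : ℂ) * kroneckerVec p.2 j := by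
    refine Finset.measurable_fun_sum _ fun j _ => Measurable.mul ?_ ?_
    · exact Complex.measurable_ofReal.comp ((measurable_pi_apply j).comp measurable_fst)
    · exact (h j).comp measurable_snd
  exact h'.norm.pow_const 2

lemma measurable_queryFormSecondMoment :
    Measurable (queryFormSecondMoment (d := d) κ) :=
  ((measurable_queryForm.pow_const 2).stronglyMeasurable.integral_prod_right
    (ν := queryLaw d κ)).measurable

lemma hasAllMoments_queryForm (g : (Fin k → Fin d) → ℝ) :
    HasAllMoments (queryForm g) (queryLaw d κ) :=
  (HasAllMoments.sum _ fun j =>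
    (HasAllMoments.const (g j : ℂ)).mul (hasAllMoments_kroneckerVec κ j)).norm.pow 2

instance : IsProbabilityMeasure (stdNormalLaw d k) := by
  unfold stdNormalLaw; infer_instance

lemma hasAllMoments_queryForm_prod :
    HasAllMoments (fun p : ((Fin k → Fin d) → ℝ) × (Fin k → Fin d → ℂ) => queryForm p.1 p.2)
      ((stdNormalLaw d k).prod (queryLaw d κ)) := by
  refine (HasAllMoments.sum _ fun j => HasAllMoments.mul ?_ ?_).norm.pow 2
  · exact ((hasAllMoments_eval_gaussian j).comp
      (measurePreserving_fst (μ := stdNormalLaw d k) (ν := queryLaw d κ))).ofReal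
  · exact (hasAllMoments_kroneckerVec κ j).comp
      (measurePreserving_snd (μ := stdNormalLaw d k) (ν := queryLaw d κ))

/-- The quadratic form is an unbiased estimator of the trace. -/
lemma integral_queryForm (g : (Fin k → Fin d) → ℝ) :
    ∫ x, queryForm g x ∂queryLaw d κ = ∑ j, g j ^ 2 := by
  have hk := hasAllMoments_kroneckerVec (d := d) κ
  have hpt : ∀ x : Fin k → Fin d → ℂ, (queryForm g x : ℂ) =
      ∑ b, ∑ a, (g a * g b : ℂ) * (kroneckerVec x a * starRingEnd ℂ (kroneckerVec x b)) := by
    intro x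
    rw [queryForm, Complex.ofReal_pow, ← Complex.conj_mul', map_sum, Finset.sum_mul]
    simp only [Finset.mul_sum, map_mul, Complex.conj_ofReal]
    refine Finset.sum_congr rfl fun a _ => Finset.sum_congr rfl fun b _ => by ring
  have hI : ∀ a b, Integrable (fun x : Fin k → Fin d → ℂ =>
      (g a * g b : ℂ) * (kroneckerVec x a * starRingEnd ℂ (kroneckerVec x b)))
      (queryLaw d κ) := fun a b =>
    ((HasAllMoments.const (g a * g b : ℂ)).mul ((hk a).mul fun p hp => (hk b p hp).star)).integrable
  apply Complex.ofReal_injective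
  rw [← integral_complex_ofReal]
  simp_rw [hpt]
  rw [integral_finsetSum _ fun b _ => integrable_finsetSum _ fun a _ => hI a b]
  simp_rw [integral_finsetSum Finset.univ fun a _ => hI a _, integral_const_mul,
    integral_kroneckerVec_mul_conj]
  simp [pow_two]

lemma variance_queryForm_le (g : (Fin k → Fin d) → ℝ) :
    Var[queryForm g; queryLaw d κ] ≤ queryFormSecondMoment κ g := by
  have h := hasAllMoments_queryForm κ g
  rw [variance_eq_sub h.memLp_two]
  exact sub_le_self _ (sq_nonneg _)

/-- Averaging over `g` first bounds the second moment by `6 E ‖x₁ ⊗ ⋯ ⊗ x_k‖⁴`, and the norm of a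
Kronecker product is multiplicative. -/
lemma integral_queryFormSecondMoment_le :
    ∫ g, queryFormSecondMoment κ g ∂stdNormalLaw d k ≤ 6 * ((d : ℝ) ^ 2 + d) ^ k := by
  have hint := ((hasAllMoments_queryForm_prod (d := d) κ).pow 2).integrable
  have hN : HasAllMoments (fun x : Fin k → Fin d → ℂ => ∑ j, ‖kroneckerVec x j‖ ^ 2)
      (queryLaw d κ) := .sum _ fun j => (hasAllMoments_kroneckerVec κ j).norm.pow 2
  unfold queryFormSecondMoment
  rw [integral_integral_swap hint]
  calc ∫ x, ∫ g, queryForm g x ^ 2 ∂stdNormalLaw d k ∂queryLaw d κ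
      ≤ ∫ x, 6 * (∑ j, ‖kroneckerVec x j‖ ^ 2) ^ 2 ∂queryLaw d κ := by
        refine integral_mono hint.integral_prod_right
          ((HasAllMoments.const (6 : ℝ)).mul (hN.pow 2)).integrable fun x => ?_
        have h := integral_norm_sum_mul_pow_four_gaussian_le
          (kroneckerVec (d := d) (k := k) x)
        simp only [queryForm, ← pow_mul]
        exact h
    _ ≤ _ := by
        rw [integral_const_mul]
        exact mul_le_mul_of_nonneg_left (integral_sum_norm_sq_sq_kroneckerVec_le κ) (by norm_num)

/-- The vectors `g` for which the second moment of the quadratic form is within the factor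
`48 · 512² · (1 + 1/d)^k` of `(tr g gᵀ)²`, and for which the trace is not zero, so that the error
allowed to the estimator is positive. -/
def concentratedSet (d : ℕ) {k : ℕ} (κ : Fin k → QueryKind) : Set ((Fin k → Fin d) → ℝ) :=
  {g | queryFormSecondMoment κ g ≤ 48 * 512 ^ 2 * (1 + 1 / (d : ℝ)) ^ k * (∑ j, g j ^ 2) ^ 2 ∧
    0 < ∑ j, g j ^ 2}

lemma measurableSet_concentratedSet : MeasurableSet (concentratedSet d κ) := by
  have := measurable_queryFormSecondMoment (d := d) κ
  have hT : Measurable fun g : (Fin k → Fin d) → ℝ => ∑ j, g j ^ 2 := by fun_prop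
  exact MeasurableSet.inter (measurableSet_le this ((hT.pow_const 2).const_mul _))
    (measurableSet_lt measurable_const hT)

/-- Outside `concentratedSet` either `|g|² < d^k / 512`, or the second moment exceeds eight times
the bound `6 (d² + d)^k` on its mean; each has probability at most `1/8`. -/
lemma stdNormalLaw_real_compl_concentratedSet_le (hd : 1 ≤ d) :
    (stdNormalLaw d k).real (concentratedSet d κ)ᶜ ≤ 1 / 4 := by
  have hd0 : (0 : ℝ) < d := by exact_mod_cast hd
  have hne : Nonempty (Fin k → Fin d) := ⟨fun _ => ⟨0, hd⟩⟩
  have hD : (0 : ℝ) < ((d : ℝ) ^ 2 + d) ^ k := by positivity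
  have hM0 : ∀ g, 0 ≤ queryFormSecondMoment (d := d) κ g := fun g =>
    integral_nonneg fun x => sq_nonneg _
  have hmk := mul_meas_ge_le_integral_of_nonneg (μ := stdNormalLaw d k) (ae_of_all _ hM0)
    ((hasAllMoments_queryForm_prod κ).pow 2).integrable.integral_prod_left
    (48 * ((d : ℝ) ^ 2 + d) ^ k)
  have h1 : (stdNormalLaw d k).real
      {g | 48 * ((d : ℝ) ^ 2 + d) ^ k ≤ queryFormSecondMoment κ g} ≤ 1 / 8 := by
    nlinarith [hmk.trans (integral_queryFormSecondMoment_le κ)]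
  have h2 := gaussian_real_sum_sq_lt_le (ι := Fin k → Fin d)
  have hsub : (concentratedSet d κ)ᶜ ⊆
      {g | ∑ j, g j ^ 2 < (Fintype.card (Fin k → Fin d) : ℝ) / 512} ∪
        {g | 48 * ((d : ℝ) ^ 2 + d) ^ k ≤ queryFormSecondMoment κ g} := by
    intro g hg
    by_contra hc
    simp only [Set.mem_union, Set.mem_ofPred_eq, not_or, not_lt, not_le, Fintype.card_pi,
      Fintype.card_fin, Finset.prod_const, Finset.card_univ, Nat.cast_pow] at hc
    obtain ⟨hT, hM⟩ := hc
    have hn : (0 : ℝ) < (d : ℝ) ^ k := by positivity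
    refine hg ⟨hM.le.trans ?_, lt_of_lt_of_le (by positivity) hT⟩
    have e : ((d : ℝ) ^ 2 + d) ^ k = (1 + 1 / (d : ℝ)) ^ k * ((d : ℝ) ^ k) ^ 2 := by
      rw [← pow_mul, mul_comm k 2, pow_mul, ← mul_pow]
      congr 1
      field_simp
    have hT' : ((d : ℝ) ^ k) ^ 2 ≤ 512 ^ 2 * (∑ j, g j ^ 2) ^ 2 := by
      rw [← mul_pow]
      exact pow_le_pow_left₀ hn.le (by linarith) 2
    rw [e]
    have hr : (0 : ℝ) ≤ (1 + 1 / (d : ℝ)) ^ k := by positivity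
    nlinarith [mul_le_mul_of_nonneg_left hT' hr]
  have h3 := (measureReal_mono (μ := stdNormalLaw d k) hsub).trans (measureReal_union_le _ _)
  refine h3.trans ((add_le_add h2 h1).trans (by norm_num))

end QueryForm

/-! ### Conditioning on an independent variable, and averages of independent copies -/

/-- Conditioning on `X` a function of `X` and an independent `Y` integrates `Y` out. -/
lemma condExp_prodMk_ae_eq_integral_of_indepFun {Ω α β F : Type*} [MeasurableSpace Ω]
    [mα : MeasurableSpace α] [MeasurableSpace β] [StandardBorelSpace β] [Nonempty β]
    [NormedAddCommGroup F] [NormedSpace ℝ F] [CompleteSpace F]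
    {P : Measure Ω} [IsProbabilityMeasure P] {μ : Measure α} {ν : Measure β}
    [IsProbabilityMeasure ν] {X : Ω → α} {Y : Ω → β} (hXm : Measurable X)
    (hX : HasLaw X μ P) (hY : HasLaw Y ν P) (hXY : IndepFun X Y P)
    {f : α × β → F} (hf : Integrable f (μ.prod ν)) :
    P[fun ω => f (X ω, Y ω) | mα.comap X] =ᵐ[P] fun ω => ∫ y, f (X ω, y) ∂ν := by
  have : IsProbabilityMeasure μ := hX.isProbabilityMeasure_iff.1 inferInstance
  have hlaw := (hXY.hasLaw_prod hX hY).map_eq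
  have hc : condDistrib Y X P =ᵐ[P.map X] Kernel.const α ν := by
    refine condDistrib_ae_eq_of_measure_eq_compProd X hY.aemeasurable ?_
    rw [hlaw, hX.map_eq, Measure.compProd_const]
  filter_upwards [condExp_prod_ae_eq_integral_condDistrib' (μ := P) hXm hY.aemeasurable
    (hlaw ▸ hf), ae_of_ae_map hXm.aemeasurable hc] with ω h1 h2
  rw [h1, h2, Kernel.const_apply]

/-- Chebyshev's inequality for the mean of `ℓ` independent copies. -/
lemma pi_real_le_abs_average_sub_le {β : Type*} [MeasurableSpace β] {ν : Measure β}
    [IsProbabilityMeasure ν] {X : β → ℝ} (hX : MemLp X 2 ν) {ℓ : ℕ} (hℓ : 0 < ℓ) {c : ℝ}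
    (hc : 0 < c) :
    (Measure.pi fun _ : Fin ℓ => ν).real
      {y | c ≤ |(1 / (ℓ : ℝ)) * ∑ t, X (y t) - ∫ x, X x ∂ν|} ≤ Var[X; ν] / (ℓ * c ^ 2) := by
  have hℓ' : (0 : ℝ) < ℓ := by exact_mod_cast hℓ
  have hXt : ∀ t : Fin ℓ, MemLp (fun y : Fin ℓ → β => X (y t)) 2 (Measure.pi fun _ => ν) :=
    fun t => hX.comp_measurePreserving (measurePreserving_eval (fun _ => ν) t)
  have hA : MemLp (fun y : Fin ℓ → β => (1 / (ℓ : ℝ)) * ∑ t, X (y t)) 2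
      (Measure.pi fun _ => ν) := (memLp_finsetSum _ fun t _ => hXt t).const_mul _
  have hmean : ∫ y : Fin ℓ → β, (1 / (ℓ : ℝ)) * ∑ t, X (y t) ∂(Measure.pi fun _ => ν) =
      ∫ x, X x ∂ν := by
    rw [integral_const_mul, integral_finsetSum _ fun t _ => (hXt t).integrable (by simp)]
    simp_rw [fun t : Fin ℓ => integral_comp_eval (μ := fun _ : Fin ℓ => ν) (f := X) (i := t) hX.1]
    simp [hℓ'.ne']
  have hvar : Var[fun y : Fin ℓ → β => (1 / (ℓ : ℝ)) * ∑ t, X (y t); Measure.pi fun _ => ν] =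
      Var[X; ν] / ℓ := by
    have h := variance_sum_pi (μ := fun _ : Fin ℓ => ν) (X := fun _ => X) fun _ => hX
    have e : (∑ t : Fin ℓ, fun y : Fin ℓ → β => X (y t)) = fun y => ∑ t, X (y t) := by
      ext y; simp
    rw [e] at h
    rw [variance_const_mul, h]
    simp only [Finset.sum_const, Finset.card_univ, Fintype.card_fin, nsmul_eq_mul]
    field_simp
  have h := meas_ge_le_variance_div_sq hA hc
  rw [hmean, hvar, div_div] at h
  exact ENNReal.toReal_le_of_le_ofReal (by have := variance_nonneg X ν; positivity) h

/-- Fubini's theorem for an event whose sections over `G` all have probability at most `c`. -/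
lemma prod_real_le_add_of_forall {α β : Type*} [MeasurableSpace α] [MeasurableSpace β]
    {μ : Measure α} {ν : Measure β} [IsProbabilityMeasure μ] [IsProbabilityMeasure ν]
    {G : Set α} (hG : MeasurableSet G) {S : Set (α × β)} (hS : MeasurableSet S) {c : ℝ}
    (hc : 0 ≤ c) (h : ∀ a ∈ G, ν.real (Prod.mk a ⁻¹' S) ≤ c) :
    (μ.prod ν).real S ≤ μ.real Gᶜ + c := by
  refine ENNReal.toReal_le_of_le_ofReal (by positivity) ?_
  rw [ENNReal.ofReal_add (by positivity) hc, ofReal_measureReal, Measure.prod_apply hS]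
  calc ∫⁻ a, ν (Prod.mk a ⁻¹' S) ∂μ ≤ ∫⁻ a, (Gᶜ.indicator 1 a + ENNReal.ofReal c) ∂μ := by
        refine lintegral_mono fun a => ?_
        by_cases ha : a ∈ G
        · refine le_add_left ?_
          rw [← ofReal_measureReal (μ := ν)]
          exact ENNReal.ofReal_le_ofReal (h a ha)
        · refine le_add_right ?_
          rw [Set.indicator_of_mem (by simpa using ha)]
          exact prob_le_one
    _ = _ := by
        rw [lintegral_add_right _ measurable_const, lintegral_indicator_one hG.compl]
        simp

/-! ### The joint law of all queries -/

/-- Grouping an independent family indexed by pairs `(t, i)` by its first index. -/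
lemma hasLaw_queries {d k ℓ : ℕ} {κ : Fin k → QueryKind} {Ω : Type*} [MeasurableSpace Ω]
    {P : Measure Ω} {x : Fin ℓ → Fin k → Ω → Fin d → ℂ}
    (hx : ∀ t i, HasLaw (x t i) (complexVectorLaw d (κ i)) P)
    (hindep : iIndepFun (fun p : Fin ℓ × Fin k => x p.1 p.2) P) :
    HasLaw (fun ω t i => x t i ω) (Measure.pi fun _ : Fin ℓ => queryLaw d κ) P := by
  have h := hindep.hasLaw_pi (μ := fun p : Fin ℓ × Fin k => complexVectorLaw d (κ p.2))
    fun p => hx p.1 p.2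
  have hc := Measure.infinitePi_map_curry
    (fun (_ : Fin ℓ) (i : Fin k) => complexVectorLaw d (κ i))
  simp only [Measure.infinitePi_eq_pi] at hc
  have hl : HasLaw (MeasurableEquiv.curry (Fin ℓ) (Fin k) (Fin d → ℂ))
      (Measure.pi fun _ : Fin ℓ => queryLaw d κ)
      (Measure.pi fun p : Fin ℓ × Fin k => complexVectorLaw d (κ p.2)) :=
    ⟨(MeasurableEquiv.measurable _).aemeasurable, hc⟩
  exact hl.comp h

/-! ### Failure probability of the estimator -/

/-- The pairs of a vector `g` and `ℓ` queries for which the relative error of the estimator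
exceeds `ε`. -/
def queryFailureSet (d k ℓ : ℕ) (ε : ℝ) :
    Set (((Fin k → Fin d) → ℝ) × (Fin ℓ → Fin k → Fin d → ℂ)) :=
  {p | ε * ∑ j, p.1 j ^ 2 <
    |(1 / (ℓ : ℝ)) * ∑ t, queryForm p.1 (p.2 t) - ∑ j, p.1 j ^ 2|}

lemma measurableSet_queryFailureSet {d k ℓ : ℕ} (ε : ℝ) :
    MeasurableSet (queryFailureSet d k ℓ ε) := by
  have hQ : ∀ t, Measurable fun p : ((Fin k → Fin d) → ℝ) × (Fin ℓ → Fin k → Fin d → ℂ) =>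
      queryForm p.1 (p.2 t) := by
    intro t
    have hφ : Measurable fun p : ((Fin k → Fin d) → ℝ) × (Fin ℓ → Fin k → Fin d → ℂ) =>
        (p.1, p.2 t) := measurable_fst.prodMk ((measurable_pi_apply t).comp measurable_snd)
    have h := (measurable_queryForm (d := d) (k := k)).comp hφ
    simpa only [Function.comp_def] using h
  have hT : Measurable fun p : ((Fin k → Fin d) → ℝ) × (Fin ℓ → Fin k → Fin d → ℂ) =>
      ∑ j, p.1 j ^ 2 :=
    Finset.measurable_fun_sum _ fun j _ =>
      ((measurable_pi_apply j).comp measurable_fst).pow_const 2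
  exact measurableSet_lt (hT.const_mul ε)
    (((Finset.measurable_fun_sum _ fun t _ => hQ t).const_mul _).sub hT).abs

/-- For `g` in `concentratedSet` the failure probability over the queries is at most `1/12` by
Chebyshev's inequality. -/
lemma prod_real_queryFailureSet_le {d k ℓ : ℕ} (κ : Fin k → QueryKind) {ε : ℝ} (hε : 0 < ε)
    (hℓ0 : (0 : ℝ) < ℓ)
    (hℓ : 12 * (48 * 512 ^ 2 * (1 + 1 / (d : ℝ)) ^ k) ≤ ℓ * ε ^ 2) (hd : 1 ≤ d) :
    ((stdNormalLaw d k).prod (Measure.pi fun _ : Fin ℓ => queryLaw d κ)).real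
      (queryFailureSet d k ℓ ε) ≤ 1 / 3 := by
  have hG := stdNormalLaw_real_compl_concentratedSet_le κ hd
  refine (prod_real_le_add_of_forall (c := 1 / 12) (measurableSet_concentratedSet κ)
    (measurableSet_queryFailureSet ε) (by norm_num) fun a ha => ?_).trans (by linarith)
  obtain ⟨hM, hT⟩ := ha
  have hch := pi_real_le_abs_average_sub_le (hasAllMoments_queryForm κ a).memLp_two
    (ℓ := ℓ) (by exact_mod_cast hℓ0) (mul_pos hε hT)
  rw [integral_queryForm] at hch
  have hsub : Prod.mk a ⁻¹' queryFailureSet d k ℓ ε ⊆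
      {y | ε * ∑ j, a j ^ 2 ≤ |(1 / (ℓ : ℝ)) * ∑ t, queryForm a (y t) - ∑ j, a j ^ 2|} := by
    intro y hy
    rw [Set.mem_ofPred_eq]
    exact le_of_lt hy
  refine (measureReal_mono hsub).trans (hch.trans ?_)
  have hV := (variance_queryForm_le κ a).trans hM
  have hT2 := mul_le_mul_of_nonneg_right hℓ (sq_nonneg (∑ j, a j ^ 2))
  rw [div_le_iff₀ (by positivity), mul_pow]
  linarith

theorem theorem8 :
    ∃ C : ℝ, 0 < C ∧
      ∀ (d k : ℕ), 1 ≤ d →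
      ∀ (κ : Fin k → QueryKind) (ℓ : ℕ)
        {Ω : Type*} [MeasurableSpace Ω] (P : Measure Ω) [IsProbabilityMeasure P]
        (g : Ω → (Fin k → Fin d) → ℝ) (x : Fin ℓ → Fin k → Ω → Fin d → ℂ),
        Measurable g →
        HasLaw g (stdNormalLaw d k) P →
        (∀ t i, Measurable (x t i)) →
        (∀ t i, HasLaw (x t i) (complexVectorLaw d (κ i)) P) →
        iIndepFun (fun p : Fin ℓ × Fin k => x p.1 p.2) P →
        IndepFun g (fun ω t i => x t i ω) P →
        (∀ t : Fin ℓ,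
          MemLp (fun ω => hermForm (rankOne (g ω)) (kroneckerVec fun i => x t i ω)) 2 P ∧
          3 / 4 ≤ P.real {ω |
            complexCondVar P (MeasurableSpace.comap g inferInstance)
                (fun ω' => hermForm (rankOne (g ω')) (kroneckerVec fun i => x t i ω')) ω
              ≤ C * (1 + 1 / (d : ℝ)) ^ k * (rankOne (g ω)).trace ^ 2}) ∧
        (∀ ε : ℝ, 0 < ε → C * (1 + 1 / (d : ℝ)) ^ k / ε ^ 2 ≤ (ℓ : ℝ) →
          2 / 3 ≤ P.real {ω |
            ‖hutchinson (rankOne (g ω)) (fun t => kroneckerVec fun i => x t i ω)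
                - ((rankOne (g ω)).trace : ℂ)‖
              ≤ ε * (rankOne (g ω)).trace}) := by
  -- The factor `12` makes the failure probability in Chebyshev's inequality at most `1/12`,
  -- which together with the `1/4` for the exceptional `g` gives `1/3`.
  refine ⟨12 * (48 * 512 ^ 2), by norm_num, ?_⟩
  intro d k hd κ ℓ Ω _ P _ g x hgm hg hxm hx hxi hgx
  have hX := hasLaw_queries hx hxi
  have hGm := measurableSet_concentratedSet (d := d) κ
  have hG := stdNormalLaw_real_compl_concentratedSet_le κ hd
  simp only [hermForm_rankOne, trace_rankOne]
  refine ⟨fun t => ?_, fun ε hε hℓ => ?_⟩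
  · have hXt : HasLaw (fun ω i => x t i ω) (queryLaw d κ) P :=
      HasLaw.comp (measurePreserving_eval (fun _ : Fin ℓ => queryLaw d κ) t).hasLaw hX
    have hgt : IndepFun g (fun ω i => x t i ω) P :=
      hgx.comp measurable_id (measurable_pi_apply t)
    have hpair := hgt.hasLaw_prod hg hXt
    have hQ := hasAllMoments_queryForm_prod (d := d) κ
    refine ⟨(hQ.ofReal.comp
      (hpair.measurePreserving (hgm.prodMk (by fun_prop)))).memLp_two, ?_⟩
    have hmean := condExp_prodMk_ae_eq_integral_of_indepFun hgm hg hXt hgt hQ.ofReal.integrable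
    have hT : HasAllMoments (fun p : ((Fin k → Fin d) → ℝ) × (Fin k → Fin d → ℂ) =>
        ∑ j, p.1 j ^ 2) ((stdNormalLaw d k).prod (queryLaw d κ)) :=
      .sum _ fun j => ((hasAllMoments_eval_gaussian j).comp
        (measurePreserving_fst (μ := stdNormalLaw d k) (ν := queryLaw d κ))).pow 2
    have hvar := condExp_prodMk_ae_eq_integral_of_indepFun hgm hg hXt hgt
      ((hQ.sub hT).pow 2).integrable
    -- The conditional mean is `tr g gᵀ`, so the conditional variance is, almost everywhere, the
    -- variance over the query vector alone with `g` held fixed.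
    have hcv : complexCondVar P (MeasurableSpace.comap g inferInstance)
        (fun ω => ((queryForm (g ω) fun i => x t i ω : ℝ) : ℂ)) =ᵐ[P]
        fun ω => Var[queryForm (g ω); queryLaw d κ] := by
      refine (condExp_congr_ae ?_).trans (hvar.trans (ae_of_all _ fun ω => ?_))
      · filter_upwards [hmean] with ω h
        rw [h, integral_complex_ofReal, integral_queryForm, ← Complex.ofReal_sub,
          Complex.norm_real, Real.norm_eq_abs, sq_abs]
      · dsimp only
        rw [variance_eq_integral (hasAllMoments_queryForm κ (g ω)).integrable.aemeasurable,
          integral_queryForm]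
    have hGP : 3 / 4 ≤ P.real (g ⁻¹' concentratedSet d κ) := by
      have h := hg.measureReal_eq (p := (· ∈ concentratedSet d κ)) hGm
      have h' := probReal_compl_eq_one_sub (μ := stdNormalLaw d k) hGm
      change P.real (g ⁻¹' concentratedSet d κ) = (stdNormalLaw d k).real (concentratedSet d κ) at h
      linarith
    refine hGP.trans (ENNReal.toReal_mono (measure_ne_top _ _) (measure_mono_ae ?_))
    filter_upwards [hcv] with ω h hω
    change complexCondVar P _ (fun ω => ((queryForm (g ω) fun i => x t i ω : ℝ) : ℂ)) ω ≤ _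
    rw [h]
    refine (variance_queryForm_le κ (g ω)).trans (hω.1.trans ?_)
    have : 0 ≤ (1 + 1 / (d : ℝ)) ^ k * (∑ j, g ω j ^ 2) ^ 2 := by positivity
    linarith
  · -- The lower bound on `ℓ` is positive, which rules out `ℓ = 0`.
    have hℓ0 : (0 : ℝ) < ℓ := lt_of_lt_of_le (by positivity) hℓ
    have hpair := hgx.hasLaw_prod hg hX
    set S := queryFailureSet d k ℓ ε
    have hSm : MeasurableSet S := measurableSet_queryFailureSet ε
    have hfail := prod_real_queryFailureSet_le κ hε hℓ0 (by
      rw [div_le_iff₀ (by positivity)] at hℓ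
      linarith) hd
    have hP : P.real ((fun ω => (g ω, fun t i => x t i ω)) ⁻¹' Sᶜ) =
        ((stdNormalLaw d k).prod (Measure.pi fun _ : Fin ℓ => queryLaw d κ)).real Sᶜ :=
      hpair.measureReal_eq (p := (· ∈ Sᶜ)) hSm.compl
    have hc := probReal_compl_eq_one_sub
      (μ := (stdNormalLaw d k).prod (Measure.pi fun _ : Fin ℓ => queryLaw d κ)) hSm
    refine le_trans (by linarith : (2 / 3 : ℝ) ≤
      P.real ((fun ω => (g ω, fun t i => x t i ω)) ⁻¹' Sᶜ)) (measureReal_mono fun ω hω => ?_)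
    have hH : hutchinson (rankOne (g ω)) (fun t => kroneckerVec fun i => x t i ω)
        - ((∑ j, g ω j ^ 2 : ℝ) : ℂ) = (((1 / (ℓ : ℝ)) *
          ∑ t, queryForm (g ω) (fun i => x t i ω) - ∑ j, g ω j ^ 2 : ℝ) : ℂ) := by
      simp only [hutchinson, hermForm_rankOne, queryForm]
      push_cast
      rfl
    simp only [Set.mem_ofPred_eq, hH, Complex.norm_real, Real.norm_eq_abs]
    exact not_lt.1 hω
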